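/- Let $k\ge 1$, $\alpha\in[0,1)$ and $\gamma\in[0,1]$. For $n>2k$ let $G$ be the $k$-connected ring graph on agents $\{1,\dots,n\}$: agent $i$ has neighbours $\mathcal N_i=\{i-k,\dots,i-1,i+1,\dots,i+k\}$ (indices modulo $n$). Each agent plays $x$ or $y$. A link is worth $V(x,x)=1+\alpha$, $V(y,y)=1$, $V(x,y)=V(y,x)=0$; put $U_i(a)=\sum_{j\in\mathcal N_i}V(a_i,a_j)$ and $W(a)=\sum_iU_i(a)$. Given disjoint sets $S_x,S_y$ of agents (those influenced by an adversarial node promoting $x$, resp. $y$), let $\tilde U_i(a)=U_i(a)+V(a_i,x)$ if $i\in S_x$, $\tilde U_i(a)=U_i(a)+V(a_i,y)$ if $i\in S_y$, and $\tilde U_i(a)=U_i(a)$ otherwise. Log-linear learning with parameter $\beta>0$ is the Markov chain on $\{x,y\}^n$ in which at each step a uniformly random agent $i$ revises its action, choosing $c\in\{x,y\}$ with probability proportional to $\exp(\beta\,\tilde U_i(c,a_{-i}))$, while all other agents keep theirs. The stochastically stable states are the support of the limit, as $\beta\to\infty$, of the stationary distribution of this chain, and $\eta(G,\alpha,S_x,S_y)$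 is the minimum of $W(a)/\max_{a'}W(a')$ over the stochastically stable states $a$. A static uninformed policy with budget $\gamma$ specifies only the numbers $n_x,n_y\ge 0$ of $x$- and $y$-adversaries, with $n_x+n_y\le\gamma n$. As it cannot place them strategically, its efficiency is the largest one over all placements: $$\eta(G,\alpha,(n_x,n_y))=\max\{\eta(G,\alpha,S_x,S_y): S_x\cap S_y=\emptyset,\ |S_x|=n_x,\ |S_y|=n_y\}.$$ Let $\eta_n^k=\min_{n_x+n_y\le\gamma n}\eta(G,\alpha,(n_x,n_y))$. Then 1. if $\gamma<k\alpha$, then $\lim_{n\to\infty}\eta_n^k=1$; 2. if $\gamma\ge k\alpha$ and $k\alpha\ne 1$, then $$\lim_{n\to\infty}\eta_n^k=\frac{(1-(k-1)\alpha)-\alpha\gamma}{(1+\alpha)(1-k\alpha)};$$ 3. minimally connected rings are the most vulnerable: for all $k\ge 1$, $\alpha\in[0,1)$, $\gamma\in[0,1]$, the limits of $\eta_n^1$ and $\eta_n^k$ exist and $\lim_{n\to\infty}\eta_n^1\le\lim_{n\to\infty}\eta_n^k$. -/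

import Mathlib

open Filter Topology

namespace CoordinationGame

/-- The two conventions. -/
inductive Convention where
  | x : Convention
  | y : Convention
  deriving DecidableEq

instance : Fintype Convention where
  elems := {.x, .y}
  complete := by intro c; cases c <;> simp

/-- A joint action profile: every one of the `n` agents chooses a convention. -/
abbrev Profile (n : ℕ) : Type := Fin n → Convention

/-- The benefit of a link: `1 + α` if both ends play `x`, `1` if both play `y`, `0` otherwise. -/
def linkBenefit (α : ℝ) : Convention → Convention → ℝ
  | .x, .x => 1 + α
  | .y, .y => 1
  | _, _ => 0

section Game

variable {n : ℕ} (G : SimpleGraph (Fin n)) (α : ℝ)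

open scoped Classical in
/-- The total benefit `U_i(a)` that agent `i` gets from its neighbours. -/
noncomputable def utility (i : Fin n) (a : Profile n) : ℝ :=
  ∑ j ∈ G.neighborFinset i, linkBenefit α (a i) (a j)

/-- The system welfare `W(a)`. -/
noncomputable def welfare (a : Profile n) : ℝ :=
  ∑ i, utility G α i a

/-- The optimal welfare, a maximum over the finitely many action profiles. -/
noncomputable def optWelfare : ℝ :=
  ⨆ a : Profile n, welfare G α a

/-- The influenced utility of agent `i`, when the agents in `Sx` (resp. `Sy`) are each attached to
one adversarial node that promotes `x` (resp. `y`). -/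
noncomputable def influencedUtility (Sx Sy : Finset (Fin n)) (i : Fin n) (a : Profile n) : ℝ :=
  if i ∈ Sx then utility G α i a + linkBenefit α (a i) .x
  else if i ∈ Sy then utility G α i a + linkBenefit α (a i) .y
  else utility G α i a

/-- Log-linear learning: the probability that the updating agent `i` selects the convention `c`
when the current state is `a`. -/
noncomputable def choiceProb (Sx Sy : Finset (Fin n)) (β : ℝ) (a : Profile n) (i : Fin n)
    (c : Convention) : ℝ :=
  Real.exp (β * influencedUtility G α Sx Sy i (Function.update a i c)) /
    ∑ c', Real.exp (β * influencedUtility G α Sx Sy i (Function.update a i c'))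

/-- The transition matrix of log-linear learning with parameter `β`: an agent is selected uniformly
at random and updates its action, all others repeat theirs. -/
noncomputable def transition (Sx Sy : Finset (Fin n)) (β : ℝ) :
    Matrix (Profile n) (Profile n) ℝ :=
  fun a a' => ∑ i, (1 / (n : ℝ)) *
    ∑ c, if a' = Function.update a i c then choiceProb G α Sx Sy β a i c else 0

/-- `μ` is a stationary probability distribution of log-linear learning with parameter `β`. -/
def IsStationary (Sx Sy : Finset (Fin n)) (β : ℝ) (μ : Profile n → ℝ) : Prop :=
  μ ∈ stdSimplex ℝ (Profile n) ∧ Matrix.vecMul μ (transition G α Sx Sy β) = μ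

/-- `p` is the limit, as `β → ∞`, of the stationary distributions of log-linear learning. -/
def IsLimitingDistribution (Sx Sy : Finset (Fin n)) (p : Profile n → ℝ) : Prop :=
  ∃ μ : ℝ → Profile n → ℝ, (∀ β > 0, IsStationary G α Sx Sy β (μ β)) ∧
    Tendsto μ atTop (𝓝 p)

/-- The stochastically stable states: the support of the limiting distribution. -/
def stochasticallyStable (Sx Sy : Finset (Fin n)) : Set (Profile n) :=
  {a | ∃ p, IsLimitingDistribution G α Sx Sy p ∧ 0 < p a}

/-- The efficiency `η`: the smallest ratio `W(a) / W(a^opt)` over the stochastically stable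
states `a`. -/
noncomputable def efficiency (Sx Sy : Finset (Fin n)) : ℝ :=
  sInf ((fun a => welfare G α a / optWelfare G α) '' stochasticallyStable G α Sx Sy)

/-- The efficiency under a static uninformed policy. Such a policy specifies only the number `nx` of
`x`-adversaries and the number `ny` of `y`-adversaries, and no strategic placement of them; it is
credited with the damage that it inflicts whatever the allocation, i.e. with the best efficiency
over all allocations of these adversaries to distinct agents. -/
noncomputable def uninformedEfficiency (nx ny : ℕ) : ℝ :=
  sSup {r | ∃ Sx Sy : Finset (Fin n), Disjoint Sx Sy ∧ Sx.card = nx ∧ Sy.card = ny ∧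
    r = efficiency G α Sx Sy}

end Game

/-- `G` is the `k`-connected ring graph on `n` agents: `N_i = {i - k, …, i - 1, i + 1, …, i + k}`
modulo `n`. -/
def IsConnectedRing {n : ℕ} (k : ℕ) (G : SimpleGraph (Fin n)) : Prop :=
  ∀ i, G.neighborSet i = {j : Fin n | ∃ d : ℕ, 1 ≤ d ∧ d ≤ k ∧
    ((j : ℕ) = ((i : ℕ) + d) % n ∨ (i : ℕ) = ((j : ℕ) + d) % n)}

/-- The infimum of the efficiency over `k`-connected ring graphs of size `n` and over static
uninformed policies that influence at most `γ * n` agents. -/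
noncomputable def worstCaseEfficiency (k : ℕ) (α γ : ℝ) (n : ℕ) : ℝ :=
  sInf {r | ∃ G : SimpleGraph (Fin n), IsConnectedRing k G ∧
    ∃ nx ny : ℕ, ((nx + ny : ℕ) : ℝ) ≤ γ * n ∧ r = uninformedEfficiency G α nx ny}

end CoordinationGame

namespace CoordinationGame

/-! The influenced game is an exact potential game, so log-linear learning is reversible with the
Gibbs measure as its unique stationary law, and the stochastically stable states are exactly the
maximizers of the potential (`mem_stochasticallyStable_iff`). Let Y be the number of agents playing
y and D the number of ordered discordant neighbour pairs. On a 2k-regular graph the potential is, up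
to a constant, -kαY - (1+α/2)D/2 plus the adversarial terms, and the efficiency of a state is 1 -
(α/(1+α))·Y/n minus a nonnegative multiple of D/n. So everything reduces to estimating Y/n and D/n
at the maximizers. Upper bound: use only y-adversaries. Whatever their placement, comparing a
maximizer with the all-y state gives (1-kα)Y ≥ n_y - kαn, hence Y/n is at least about (γ-kα)/(1-kα)
when kα < 1. Lower bound: one good placement suffices. Concentrate b of the y-adversaries on an
interval, which is sacrificed, and spread the rest evenly over the other agents with density at most
kα(1-δ), slightly below the threshold at which converting an agent pays off. Even spreading
(`exists_evenly_spread`) costs only a bounded error per boundary of the y-region, and the discord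
term of the potential pays for it. Comparison with the state in which only the interval plays y
shows that a maximizer has O(1) agents playing y outside it and D = O(1)
(`IsConnectedRing.le_uninformedEfficiency`). The smallest admissible b is about (n_y - dn)/(1-d)
with d = kα(1-δ); letting n → ∞ and then δ → 0 matches the upper bound. -/

theorem linkBenefit_comm (α : ℝ) (c d : Convention) :
    linkBenefit α c d = linkBenefit α d c := by
  cases c <;> cases d <;> rfl

/-- The benefit that an agent playing `c` gets from the adversary attached to it, if any. -/
noncomputable def adversarialBenefit {n : ℕ} (α : ℝ) (Sx Sy : Finset (Fin n)) (i : Fin n)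
    (c : Convention) : ℝ :=
  if i ∈ Sx then linkBenefit α c .x else if i ∈ Sy then linkBenefit α c .y else 0

/-- The potential of the influenced game. -/
noncomputable def potential {n : ℕ} (G : SimpleGraph (Fin n)) (α : ℝ) (Sx Sy : Finset (Fin n))
    (a : Profile n) : ℝ :=
  welfare G α a / 2 + ∑ i, adversarialBenefit α Sx Sy i (a i)

/-! ### Log-linear learning: potential, reversibility, stochastic stability -/

section LogLinear

variable {n : ℕ} (G : SimpleGraph (Fin n)) (α : ℝ) (Sx Sy : Finset (Fin n))

theorem influencedUtility_eq (i : Fin n) (a : Profile n) :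
    influencedUtility G α Sx Sy i a = utility G α i a + adversarialBenefit α Sx Sy i (a i) := by
  unfold influencedUtility adversarialBenefit
  split_ifs <;> simp

open scoped Classical in
theorem utility_eq_sum (i : Fin n) (a : Profile n) :
    utility G α i a = ∑ j, if G.Adj i j then linkBenefit α (a i) (a j) else 0 := by
  unfold utility
  rw [← Finset.sum_filter]
  congr 1
  ext j
  simp

open scoped Classical in
theorem welfare_eq_two_mul_utility_add (i : Fin n) (a : Profile n) :
    welfare G α a = 2 * utility G α i a + ∑ j ∈ Finset.univ.erase i, ∑ l ∈ Finset.univ.erase i,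
      if G.Adj j l then linkBenefit α (a j) (a l) else 0 := by
  set F : Fin n → Fin n → ℝ := fun j l => if G.Adj j l then linkBenefit α (a j) (a l) else 0
    with hF
  have hself : F i i = 0 := by simp [hF]
  have hsymm : ∀ j, F j i = F i j := fun j => by simp [hF, G.adj_comm j i, linkBenefit_comm α (a j)]
  have hrow : ∀ j, utility G α j a = F j i + ∑ l ∈ Finset.univ.erase i, F j l := fun j => by
    rw [utility_eq_sum, ← Finset.add_sum_erase _ _ (Finset.mem_univ i)]
  unfold welfare
  rw [← Finset.add_sum_erase _ _ (Finset.mem_univ i)]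
  simp_rw [hrow, Finset.sum_add_distrib, hsymm, hself]
  ring

-- Half the welfare counts each link once, so after subtracting the influenced utility of `i` only
-- links and adversarial terms away from `i` remain. These do not involve the action of `i`, which
-- makes `potential` an exact potential.
open scoped Classical in
theorem potential_sub_influencedUtility_update (i : Fin n) (c : Convention) (a : Profile n) :
    potential G α Sx Sy (Function.update a i c) -
        influencedUtility G α Sx Sy i (Function.update a i c) =
      potential G α Sx Sy a - influencedUtility G α Sx Sy i a := by
  have key : ∀ b : Profile n, potential G α Sx Sy b - influencedUtility G α Sx Sy i b =
      (∑ j ∈ Finset.univ.erase i, ∑ l ∈ Finset.univ.erase i,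
        if G.Adj j l then linkBenefit α (b j) (b l) else 0) / 2 +
      ∑ j ∈ Finset.univ.erase i, adversarialBenefit α Sx Sy j (b j) := fun b => by
    rw [potential, influencedUtility_eq, welfare_eq_two_mul_utility_add G α i b,
      ← Finset.add_sum_erase _ (fun j => adversarialBenefit α Sx Sy j (b j)) (Finset.mem_univ i)]
    ring
  rw [key, key]
  congr 1
  · congr 1
    refine Finset.sum_congr rfl fun j hj => Finset.sum_congr rfl fun l hl => ?_
    rw [Function.update_of_ne (Finset.ne_of_mem_erase hj),
      Function.update_of_ne (Finset.ne_of_mem_erase hl)]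
  · refine Finset.sum_congr rfl fun j hj => ?_
    rw [Function.update_of_ne (Finset.ne_of_mem_erase hj)]

/-- The unnormalized Gibbs weight of a profile. -/
noncomputable def gibbsWeight (β : ℝ) (a : Profile n) : ℝ :=
  Real.exp (β * potential G α Sx Sy a)

theorem gibbsWeight_pos (β : ℝ) (a : Profile n) : 0 < gibbsWeight G α Sx Sy β a :=
  Real.exp_pos _

/-- The Gibbs distribution of the influenced game. -/
noncomputable def gibbs (β : ℝ) (a : Profile n) : ℝ :=
  gibbsWeight G α Sx Sy β a / ∑ b, gibbsWeight G α Sx Sy β b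

theorem choiceProb_eq (β : ℝ) (a : Profile n) (i : Fin n) (c : Convention) :
    choiceProb G α Sx Sy β a i c = gibbsWeight G α Sx Sy β (Function.update a i c) /
      ∑ c', gibbsWeight G α Sx Sy β (Function.update a i c') := by
  have h : ∀ c', gibbsWeight G α Sx Sy β (Function.update a i c') =
      Real.exp (β * (potential G α Sx Sy a - influencedUtility G α Sx Sy i a)) *
        Real.exp (β * influencedUtility G α Sx Sy i (Function.update a i c')) := fun c' => by
    rw [gibbsWeight, ← Real.exp_add, ← potential_sub_influencedUtility_update G α Sx Sy i c' a]
    ring_nf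
  simp_rw [choiceProb, h]
  rw [← Finset.mul_sum, mul_div_mul_left _ _ (Real.exp_pos _).ne']

theorem sum_gibbsWeight_update_pos (β : ℝ) (a : Profile n) (i : Fin n) :
    0 < ∑ c, gibbsWeight G α Sx Sy β (Function.update a i c) :=
  Finset.sum_pos (fun _ _ => gibbsWeight_pos ..) ⟨.x, Finset.mem_univ _⟩

theorem choiceProb_pos (β : ℝ) (a : Profile n) (i : Fin n) (c : Convention) :
    0 < choiceProb G α Sx Sy β a i c := by
  rw [choiceProb_eq]
  exact div_pos (gibbsWeight_pos ..) (sum_gibbsWeight_update_pos ..)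

theorem sum_choiceProb (β : ℝ) (a : Profile n) (i : Fin n) :
    ∑ c, choiceProb G α Sx Sy β a i c = 1 := by
  simp_rw [choiceProb_eq]
  rw [← Finset.sum_div, div_self (sum_gibbsWeight_update_pos ..).ne']

theorem sum_transition_mul (β : ℝ) (a : Profile n) (h : Profile n → ℝ) :
    ∑ b, transition G α Sx Sy β a b * h b =
      ∑ i, ∑ c, 1 / (n : ℝ) * choiceProb G α Sx Sy β a i c * h (Function.update a i c) := by
  simp_rw [transition, Finset.sum_mul, Finset.mul_sum, Finset.sum_mul]
  rw [Finset.sum_comm]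
  refine Finset.sum_congr rfl fun i _ => ?_
  rw [Finset.sum_comm]
  refine Finset.sum_congr rfl fun c _ => ?_
  rw [Finset.sum_eq_single (Function.update a i c)]
  · simp
  · intro b _ hb
    simp [hb]
  · simp

/-- Detailed balance holds agent by agent: profiles differing only at `i` share the same normalizing
sum in `choiceProb_eq`. -/
theorem gibbsWeight_mul_transition (β : ℝ) (a b : Profile n) :
    gibbsWeight G α Sx Sy β a * transition G α Sx Sy β a b =
      gibbsWeight G α Sx Sy β b * transition G α Sx Sy β b a := by
  simp_rw [transition, Finset.mul_sum]
  refine Finset.sum_congr rfl fun i _ => ?_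
  by_cases hab : ∃ c, b = Function.update a i c
  · obtain ⟨c, rfl⟩ := hab
    rw [Finset.sum_eq_single c, Finset.sum_eq_single (a i)]
    · simp only [Function.update_idem, Function.update_eq_self, if_true, choiceProb_eq]
      ring
    · intro c' _ hc'
      rw [if_neg, mul_zero, mul_zero]
      intro h
      apply hc'
      simpa using (congrFun h i).symm
    · simp
    · intro c' _ hc'
      rw [if_neg, mul_zero, mul_zero]
      intro h
      exact hc' (Function.update_injective a i h).symm
    · simp
  · rw [Finset.sum_eq_zero, Finset.sum_eq_zero]
    · intro c _
      rw [if_neg, mul_zero, mul_zero]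
      rintro h
      exact hab ⟨b i, by rw [h]; simp⟩
    · intro c _
      rw [if_neg, mul_zero, mul_zero]
      exact fun h => hab ⟨c, h⟩

theorem sum_transition (hn : 0 < n) (β : ℝ) (a : Profile n) :
    ∑ b, transition G α Sx Sy β a b = 1 := by
  have h := sum_transition_mul G α Sx Sy β a fun _ => 1
  simp only [mul_one, ← Finset.mul_sum, sum_choiceProb] at h
  rw [h]
  have : (n : ℝ) ≠ 0 := by positivity
  simp [this]

theorem sum_gibbsWeight_pos (β : ℝ) : 0 < ∑ b, gibbsWeight G α Sx Sy β b :=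
  Finset.sum_pos (fun _ _ => gibbsWeight_pos ..) ⟨fun _ => .x, Finset.mem_univ _⟩

theorem isStationary_gibbs (hn : 0 < n) (β : ℝ) :
    IsStationary G α Sx Sy β (gibbs G α Sx Sy β) := by
  refine ⟨⟨fun a => (div_pos (gibbsWeight_pos ..) (sum_gibbsWeight_pos ..)).le, ?_⟩, ?_⟩
  · simp_rw [gibbs]
    rw [← Finset.sum_div, div_self (sum_gibbsWeight_pos ..).ne']
  · ext b
    simp_rw [Matrix.vecMul, dotProduct, gibbs, div_mul_eq_mul_div, gibbsWeight_mul_transition]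
    rw [← Finset.sum_div, ← Finset.mul_sum, sum_transition G α Sx Sy hn, mul_one]

/-- Maximum principle: every single-agent update has positive probability, so it carries a maximum
point of `h` to a maximum point. Changing agents one at a time reaches every profile. -/
theorem eq_of_harmonic (hn : 0 < n) (β : ℝ) (h : Profile n → ℝ)
    (hh : ∀ a, ∑ b, transition G α Sx Sy β a b * h b = h a) (a b : Profile n) : h a = h b := by
  obtain ⟨m, -, hm⟩ := Finset.exists_max_image Finset.univ h ⟨a, Finset.mem_univ a⟩
  have hm' : ∀ a, h a ≤ h m := fun a => hm a (Finset.mem_univ a)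
  have step : ∀ a, h a = h m → ∀ i c, h (Function.update a i c) = h m := by
    intro a ha i c
    have h0 : ∑ i, ∑ c, 1 / (n : ℝ) * choiceProb G α Sx Sy β a i c *
        (h m - h (Function.update a i c)) = 0 := by
      have h1 := sum_transition_mul G α Sx Sy β a fun b => h m - h b
      rw [← h1]
      simp_rw [mul_sub, Finset.sum_sub_distrib]
      rw [hh, ← Finset.sum_mul, sum_transition G α Sx Sy hn, ha]
      ring
    have hpos : ∀ i c, 0 < 1 / (n : ℝ) * choiceProb G α Sx Sy β a i c := fun i c =>
      mul_pos (by positivity) (choiceProb_pos ..)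
    have hnn : ∀ i c, 0 ≤ 1 / (n : ℝ) * choiceProb G α Sx Sy β a i c *
        (h m - h (Function.update a i c)) := fun i c =>
      mul_nonneg (hpos i c).le (sub_nonneg.2 (hm' _))
    have h2 := (Finset.sum_eq_zero_iff_of_nonneg
      (fun i _ => Finset.sum_nonneg fun c _ => hnn i c)).1 h0 i (Finset.mem_univ i)
    have h3 := (Finset.sum_eq_zero_iff_of_nonneg (fun c _ => hnn i c)).1 h2 c (Finset.mem_univ c)
    rcases mul_eq_zero.1 h3 with h4 | h4
    · exact absurd h4 (hpos i c).ne'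
    · linarith
  have all : ∀ b, h b = h m := by
    intro b
    have : ∀ s : Finset (Fin n), h (s.piecewise b m) = h m := by
      intro s
      induction s using Finset.induction_on with
      | empty => simp
      | insert j s _ ih => rw [Finset.piecewise_insert]; exact step _ ih _ _
    simpa using this Finset.univ
  rw [all a, all b]

/-- By reversibility, the density of a stationary law with respect to the Gibbs weights is harmonic,
hence constant. -/
theorem IsStationary.eq_gibbs (hn : 0 < n) {β : ℝ} {μ : Profile n → ℝ}
    (hμ : IsStationary G α Sx Sy β μ) : μ = gibbs G α Sx Sy β := by
  obtain ⟨⟨-, hsum⟩, hst⟩ := hμ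
  set w := gibbsWeight G α Sx Sy β with hw
  have hwp : ∀ a, 0 < w a := gibbsWeight_pos G α Sx Sy β
  have hh : ∀ a, ∑ b, transition G α Sx Sy β a b * (μ b / w b) = μ a / w a := by
    intro a
    rw [eq_div_iff (hwp a).ne']
    conv_rhs => rw [← hst]
    simp_rw [Matrix.vecMul, dotProduct, Finset.sum_mul]
    refine Finset.sum_congr rfl fun b _ => ?_
    have h1 : w b ≠ 0 := (hwp b).ne'
    calc _ = (w a * transition G α Sx Sy β a b) * μ b / w b := by ring
      _ = (w b * transition G α Sx Sy β b a) * μ b / w b := by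
        rw [hw, gibbsWeight_mul_transition]
      _ = _ := by field_simp
  have hc := eq_of_harmonic G α Sx Sy hn β _ hh
  ext a
  have h2 : ∀ b, μ b = μ a / w a * w b := fun b => by
    rw [hc a b, div_mul_cancel₀ _ (hwp b).ne']
  have h3 : μ a / w a * ∑ b, w b = 1 := by
    rw [Finset.mul_sum, ← hsum]
    exact Finset.sum_congr rfl fun b _ => (h2 b).symm
  have h4 : (0 : ℝ) < ∑ b, w b := sum_gibbsWeight_pos G α Sx Sy β
  rw [gibbs, ← hw, eq_div_iff h4.ne']
  have := (hwp a).ne'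
  field_simp at h3
  linarith

-- Dividing all weights by that of the maximizer `m` leaves exponentials of β times nonpositive
-- gaps, so the limit is uniform on the maximizers.
open scoped Classical in
theorem tendsto_gibbs (m : Profile n) (hm : ∀ b, potential G α Sx Sy b ≤ potential G α Sx Sy m) :
    Tendsto (gibbs G α Sx Sy) atTop (𝓝 fun a =>
      (if potential G α Sx Sy a = potential G α Sx Sy m then (1 : ℝ) else 0) /
        ∑ b, if potential G α Sx Sy b = potential G α Sx Sy m then (1 : ℝ) else 0) := by
  set Φ := potential G α Sx Sy with hΦ
  rw [tendsto_pi_nhds]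
  intro a
  have hexp : ∀ b, Tendsto (fun β : ℝ => Real.exp (β * (Φ b - Φ m))) atTop
      (𝓝 (if Φ b = Φ m then (1 : ℝ) else 0)) := by
    intro b
    split_ifs with h
    · simp [h]
    · have hlt : Φ b - Φ m < 0 := sub_neg.2 (lt_of_le_of_ne (hm b) h)
      exact Real.tendsto_exp_atBot.comp (tendsto_id.atTop_mul_const_of_neg hlt)
  have hne : (∑ b, if Φ b = Φ m then (1 : ℝ) else 0) ≠ 0 := by
    refine (Finset.sum_pos' (fun b _ => by split_ifs <;> norm_num) ⟨m, Finset.mem_univ m, ?_⟩).ne'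
    simp
  have := (hexp a).div (tendsto_finsetSum Finset.univ fun b _ => hexp b) hne
  refine this.congr fun β => ?_
  have h1 : ∀ b, gibbsWeight G α Sx Sy β b =
      Real.exp (β * Φ m) * Real.exp (β * (Φ b - Φ m)) := fun b => by
    rw [gibbsWeight, ← Real.exp_add, ← hΦ]
    ring_nf
  simp_rw [gibbs, h1]
  rw [← Finset.mul_sum, mul_div_mul_left _ _ (Real.exp_pos _).ne']
  rfl

theorem exists_forall_potential_le :
    ∃ m, ∀ b, potential G α Sx Sy b ≤ potential G α Sx Sy m := by
  obtain ⟨m, -, hm⟩ := Finset.exists_max_image Finset.univ (potential G α Sx Sy)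
    ⟨fun _ => .x, Finset.mem_univ _⟩
  exact ⟨m, fun b => hm b (Finset.mem_univ b)⟩

/-- The stochastically stable states are the maximizers of the potential. -/
theorem mem_stochasticallyStable_iff (hn : 0 < n) (a : Profile n) :
    a ∈ stochasticallyStable G α Sx Sy ↔
      ∀ b, potential G α Sx Sy b ≤ potential G α Sx Sy a := by
  classical
  constructor
  · rintro ⟨p, ⟨μ, hμ, hlim⟩, hp⟩
    obtain ⟨m, hm⟩ := exists_forall_potential_le G α Sx Sy
    have h1 : Tendsto μ atTop (𝓝 _) := (tendsto_gibbs G α Sx Sy m hm).congr' <| by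
      filter_upwards [eventually_gt_atTop 0] with β hβ
      exact ((hμ β hβ).eq_gibbs G α Sx Sy hn).symm
    rw [tendsto_nhds_unique hlim h1] at hp
    by_cases h : potential G α Sx Sy a = potential G α Sx Sy m
    · rw [h]; exact hm
    · simp [h] at hp
  · intro ha
    refine ⟨_, ⟨gibbs G α Sx Sy, fun β _ => isStationary_gibbs G α Sx Sy hn β,
      tendsto_gibbs G α Sx Sy a ha⟩, ?_⟩
    refine div_pos (by simp) ?_
    exact Finset.sum_pos' (fun b _ => by split_ifs <;> norm_num) ⟨a, Finset.mem_univ a, by simp⟩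

end LogLinear

/-- The indicator of the convention `y`. -/
noncomputable def Convention.indY : Convention → ℝ
  | .x => 0
  | .y => 1

theorem Convention.indY_nonneg (c : Convention) : 0 ≤ c.indY := by
  cases c <;> simp [Convention.indY]

theorem Convention.indY_le_one (c : Convention) : c.indY ≤ 1 := by
  cases c <;> simp [Convention.indY]

/-! ### Welfare and potential in terms of the number of y-players and the discord -/

section Counting

variable {n : ℕ} (G : SimpleGraph (Fin n)) (α : ℝ) (Sx Sy : Finset (Fin n))

/-- The number of agents that play `y`. -/
noncomputable def numY (a : Profile n) : ℝ := ∑ i, (a i).indY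

open scoped Classical in
/-- The number of ordered pairs of neighbours that play different conventions. -/
noncomputable def discord (a : Profile n) : ℝ :=
  ∑ i, ∑ j, if G.Adj i j ∧ a i ≠ a j then 1 else 0

theorem numY_nonneg (a : Profile n) : 0 ≤ numY a :=
  Finset.sum_nonneg fun _ _ => Convention.indY_nonneg _

theorem discord_nonneg (a : Profile n) : 0 ≤ discord G a :=
  Finset.sum_nonneg fun _ _ => Finset.sum_nonneg fun _ _ => by split_ifs <;> norm_num

theorem discord_const (c : Convention) : discord G (fun _ => c) = 0 := by
  simp [discord]

open scoped Classical in
theorem welfare_eq {r : ℕ} (hG : ∀ i, (G.neighborFinset i).card = r) (a : Profile n) :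
    welfare G α a = r * n * (1 + α) - α * r * numY a - (1 + α / 2) * discord G a := by
  -- The link benefit is affine in the two indicators apart from a discord penalty; regularity then
  -- turns the linear part into a multiple of `numY`.
  have hlink : ∀ c d, linkBenefit α c d = (1 + α) - α / 2 * c.indY - α / 2 * d.indY -
      (1 + α / 2) * (if c ≠ d then 1 else 0) := by
    intro c d
    cases c <;> cases d <;> simp [linkBenefit, Convention.indY] <;> ring
  have hdeg : ∀ i, ∑ j, (if G.Adj i j then (1 : ℝ) else 0) = r := fun i => by
    rw [← hG i, Finset.sum_boole]
    congr 2
    ext j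
    simp
  have h1 : ∀ i, utility G α i a = (1 + α) * ∑ j, (if G.Adj i j then (1 : ℝ) else 0)
      - α / 2 * (∑ j, (if G.Adj i j then (1 : ℝ) else 0) * (a i).indY)
      - α / 2 * (∑ j, (if G.Adj i j then (1 : ℝ) else 0) * (a j).indY)
      - (1 + α / 2) * ∑ j, (if G.Adj i j ∧ a i ≠ a j then 1 else 0) := fun i => by
    rw [utility_eq_sum]
    simp_rw [Finset.mul_sum, ← Finset.sum_sub_distrib]
    refine Finset.sum_congr rfl fun j _ => ?_
    rw [hlink]
    by_cases h : G.Adj i j <;> simp [h]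
  have h2 : ∑ i, ∑ j, (if G.Adj i j then (1 : ℝ) else 0) * (a i).indY = r * numY a := by
    simp_rw [← Finset.sum_mul, hdeg, numY, Finset.mul_sum]
  have h3 : ∑ i, ∑ j, (if G.Adj i j then (1 : ℝ) else 0) * (a j).indY = r * numY a := by
    rw [Finset.sum_comm]
    simp_rw [← Finset.sum_mul, G.adj_comm, hdeg, numY, Finset.mul_sum]
  unfold welfare
  simp_rw [h1, Finset.sum_sub_distrib, ← Finset.mul_sum, h2, h3, hdeg, ← discord.eq_1]
  simp
  ring

theorem sum_adversarialBenefit (hd : Disjoint Sx Sy) (a : Profile n) :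
    ∑ i, adversarialBenefit α Sx Sy i (a i) =
      (1 + α) * (Sx.card - ∑ i ∈ Sx, (a i).indY) + ∑ i ∈ Sy, (a i).indY := by
  have h : ∀ i, adversarialBenefit α Sx Sy i (a i) =
      (if i ∈ Sx then (1 + α) * (1 - (a i).indY) else 0) + if i ∈ Sy then (a i).indY else 0 := by
    intro i
    unfold adversarialBenefit
    by_cases hx : i ∈ Sx
    · have hy : i ∉ Sy := Finset.disjoint_left.1 hd hx
      cases a i <;> simp [hx, hy, linkBenefit, Convention.indY]
    · cases a i <;> simp [hx, linkBenefit, Convention.indY]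
  simp_rw [h, Finset.sum_add_distrib, Finset.sum_ite_mem, Finset.univ_inter, ← Finset.mul_sum,
    Finset.sum_sub_distrib]
  simp

open scoped Classical in
theorem potential_eq {r : ℕ} (hG : ∀ i, (G.neighborFinset i).card = r) (hd : Disjoint Sx Sy)
    (a : Profile n) :
    potential G α Sx Sy a =
      (r * n * (1 + α) - α * r * numY a - (1 + α / 2) * discord G a) / 2 +
        ((1 + α) * (Sx.card - ∑ i ∈ Sx, (a i).indY) + ∑ i ∈ Sy, (a i).indY) := by
  rw [potential, welfare_eq G α hG, sum_adversarialBenefit α Sx Sy hd]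

open scoped Classical in
theorem optWelfare_eq (hα : 0 ≤ α) {r : ℕ} (hG : ∀ i, (G.neighborFinset i).card = r) :
    optWelfare G α = r * n * (1 + α) := by
  have : Nonempty (Profile n) := ⟨fun _ => .x⟩
  apply le_antisymm
  · refine ciSup_le fun a => ?_
    rw [welfare_eq G α hG]
    have := mul_nonneg (mul_nonneg hα (Nat.cast_nonneg r)) (numY_nonneg a)
    have := mul_nonneg (by linarith : 0 ≤ 1 + α / 2) (discord_nonneg G a)
    linarith
  · have h := le_ciSup (Set.finite_range (welfare G α)).bddAbove fun _ => .x
    rw [welfare_eq G α hG, discord_const] at h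
    simpa [numY, Convention.indY, optWelfare] using h

open scoped Classical in
theorem welfare_div_optWelfare (hα : 0 ≤ α) (hn : 0 < n) {r : ℕ} (hr : 0 < r)
    (hG : ∀ i, (G.neighborFinset i).card = r) (a : Profile n) :
    welfare G α a / optWelfare G α =
      1 - α / (1 + α) * (numY a / n) - (1 + α / 2) * discord G a / (r * n * (1 + α)) := by
  rw [optWelfare_eq G α hα hG, welfare_eq G α hG]
  have : (n : ℝ) ≠ 0 := by positivity
  have : (r : ℝ) ≠ 0 := by positivity
  have : 1 + α ≠ 0 := by positivity
  field_simp

end Counting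

/-! ### Geometry of the ring: degrees and boundaries -/

section Ring

variable {n k : ℕ}

theorem add_mod_cases {i d : ℕ} (hi : i < n) (hd : d < n) :
    (i + d < n ∧ (i + d) % n = i + d) ∨ (n ≤ i + d ∧ (i + d) % n = i + d - n) := by
  rcases lt_or_ge (i + d) n with h | h
  · exact .inl ⟨h, Nat.mod_eq_of_lt h⟩
  · refine .inr ⟨h, ?_⟩
    rw [Nat.mod_eq_sub_mod h, Nat.mod_eq_of_lt (by omega)]

theorem IsConnectedRing.adj_iff {G : SimpleGraph (Fin n)} (hG : IsConnectedRing k G)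
    (i j : Fin n) : G.Adj i j ↔ ∃ d : ℕ, 1 ≤ d ∧ d ≤ k ∧
      ((j : ℕ) = ((i : ℕ) + d) % n ∨ (i : ℕ) = ((j : ℕ) + d) % n) := by
  rw [← SimpleGraph.mem_neighborSet, hG i, Set.mem_ofPred_eq]

theorem exists_isConnectedRing (hn : 2 * k < n) : ∃ G : SimpleGraph (Fin n),
    IsConnectedRing k G := by
  refine ⟨{
    Adj := fun i j => ∃ d : ℕ, 1 ≤ d ∧ d ≤ k ∧
      ((j : ℕ) = ((i : ℕ) + d) % n ∨ (i : ℕ) = ((j : ℕ) + d) % n)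
    symm := ⟨fun i j ⟨d, h1, h2, h3⟩ => ⟨d, h1, h2, h3.symm⟩⟩
    loopless := ⟨?_⟩ }, fun i => rfl⟩
  rintro i ⟨d, h1, h2, h3⟩
  have := add_mod_cases i.2 (by omega : d < n)
  omega

open scoped Classical in
theorem IsConnectedRing.card_neighborFinset {G : SimpleGraph (Fin n)} (hG : IsConnectedRing k G)
    (hn : 2 * k < n) (i : Fin n) : (G.neighborFinset i).card = 2 * k := by
  have hpos : 0 < n := by omega
  -- A backward step by d is a forward step by n - d; the two ranges of shifts are disjoint because
  -- 2k < n.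
  have h : G.neighborFinset i = (Finset.Icc 1 k ∪ Finset.Ico (n - k) n).image
      fun d => (⟨(i + d) % n, Nat.mod_lt _ hpos⟩ : Fin n) := by
    ext j
    rw [SimpleGraph.mem_neighborFinset, hG.adj_iff]
    simp only [Finset.mem_image, Finset.mem_union, Finset.mem_Icc, Finset.mem_Ico, Fin.ext_iff]
    constructor
    · rintro ⟨d, h1, h2, h3 | h3⟩
      · exact ⟨d, by omega, h3.symm⟩
      · refine ⟨n - d, by omega, ?_⟩
        have := add_mod_cases j.2 (by omega : d < n)
        have := add_mod_cases i.2 (by omega : n - d < n)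
        omega
    · rintro ⟨d, h1 | h1, h3⟩
      · exact ⟨d, by omega, by omega, .inl h3.symm⟩
      · refine ⟨n - d, by omega, by omega, .inr ?_⟩
        have := add_mod_cases i.2 (by omega : d < n)
        have := add_mod_cases j.2 (by omega : n - d < n)
        omega
  rw [h, Finset.card_image_of_injOn, Finset.card_union_of_disjoint]
  · simp
    omega
  · rw [Finset.disjoint_left]
    simp
    omega
  · intro d hd d' hd' he
    simp only [Finset.coe_union, Finset.coe_Icc, Finset.coe_Ico, Set.mem_union, Set.mem_Icc,
      Set.mem_Ico, Fin.ext_iff] at hd hd' he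
    have := add_mod_cases i.2 (by omega : d < n)
    have := add_mod_cases i.2 (by omega : d' < n)
    omega

/-- The indicator of the set of agents that play `y`, extended by zero. -/
noncomputable def indYExt (a : Profile n) (t : ℕ) : ℝ :=
  if h : t < n then (a ⟨t, h⟩).indY else 0

theorem indYExt_coe (a : Profile n) (i : Fin n) : indYExt a i = (a i).indY := by
  simp [indYExt]

theorem indYExt_nonneg (a : Profile n) (t : ℕ) : 0 ≤ indYExt a t := by
  unfold indYExt
  split_ifs
  · exact Convention.indY_nonneg _
  · rfl

theorem indYExt_le_one (a : Profile n) (t : ℕ) : indYExt a t ≤ 1 := by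
  unfold indYExt
  split_ifs
  · exact Convention.indY_le_one _
  · exact zero_le_one

/-- Links between consecutive agents alone suffice: each such boundary is counted twice in the
ordered discord. The extra 1 covers the last index, where the extension by zero may jump instead of
wrapping around. -/
theorem IsConnectedRing.sum_abs_le_discord {G : SimpleGraph (Fin n)} (hG : IsConnectedRing k G)
    (hk : 1 ≤ k) (hn : 2 * k < n) (a : Profile n) :
    ∑ t ∈ Finset.range n, |indYExt a (t + 1) - indYExt a t| ≤ discord G a / 2 + 1 := by
  classical
  have hpos : 0 < n := by omega
  set s : Fin n → Fin n := fun i => ⟨(i + 1) % n, Nat.mod_lt _ hpos⟩ with hs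
  have hcut : 2 * ∑ i, (if a i ≠ a (s i) then (1 : ℝ) else 0) ≤ discord G a := by
    have h1 : ∑ i, ∑ j, (if j = s i then (if a i ≠ a j then (1 : ℝ) else 0) else 0) =
        ∑ i, (if a i ≠ a (s i) then (1 : ℝ) else 0) := by
      simp
    have h2 : ∑ i, ∑ j, (if i = s j then (if a i ≠ a j then (1 : ℝ) else 0) else 0) =
        ∑ i, (if a i ≠ a (s i) then (1 : ℝ) else 0) := by
      rw [Finset.sum_comm, ← h1]
      simp only [ne_comm]
    rw [two_mul]
    nth_rewrite 1 [← h1]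
    rw [← h2, ← Finset.sum_add_distrib]
    refine Finset.sum_le_sum fun i _ => ?_
    rw [← Finset.sum_add_distrib]
    refine Finset.sum_le_sum fun j _ => ?_
    by_cases hne : a i = a j
    · simp [hne]
    · have hi := add_mod_cases i.2 (by omega : 1 < n)
      have hj := add_mod_cases j.2 (by omega : 1 < n)
      by_cases h3 : j = s i
      · have h4 : i ≠ s j := by
          intro h4
          simp only [hs, Fin.ext_iff] at h3 h4
          omega
        have h5 : G.Adj i j := (hG.adj_iff i j).2 ⟨1, le_rfl, hk, .inl (congrArg Fin.val h3)⟩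
        rw [if_pos h3, if_neg h4, if_pos hne, if_pos ⟨h5, hne⟩, add_zero]
      · by_cases h4 : i = s j
        · have h5 : G.Adj i j :=
            (hG.adj_iff i j).2 ⟨1, le_rfl, hk, .inr (congrArg Fin.val h4)⟩
          rw [if_neg h3, if_pos h4, if_pos hne, if_pos ⟨h5, hne⟩, zero_add]
        · rw [if_neg h3, if_neg h4, add_zero]
          split_ifs <;> norm_num
  have hlast : ∑ i : Fin n, (if (i : ℕ) = n - 1 then (1 : ℝ) else 0) ≤ 1 := by
    rw [Finset.sum_eq_single (⟨n - 1, by omega⟩ : Fin n)]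
    · simp
    · intro i _ hi
      rw [if_neg]
      exact fun h => hi (Fin.ext h)
    · simp
  have hstep : ∀ i : Fin n, |indYExt a (i + 1) - indYExt a i| ≤
      (if a i ≠ a (s i) then (1 : ℝ) else 0) + if (i : ℕ) = n - 1 then (1 : ℝ) else 0 := by
    intro i
    by_cases hi : (i : ℕ) = n - 1
    · rw [if_pos hi]
      have h1 : |indYExt a (i + 1) - indYExt a i| ≤ 1 := by
        rw [abs_le]
        constructor <;> linarith [indYExt_nonneg a i, indYExt_nonneg a (i + 1),
          indYExt_le_one a i, indYExt_le_one a (i + 1)]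
      split_ifs <;> linarith
    · have hlt : (i : ℕ) + 1 < n := by omega
      have h2 : indYExt a (i + 1) = (a (s i)).indY := by
        simp [indYExt, hlt, hs, Nat.mod_eq_of_lt hlt]
      rw [if_neg hi, h2, indYExt_coe]
      cases a i <;> cases a (s i) <;> simp [Convention.indY]
  rw [Finset.sum_range fun t => |indYExt a (t + 1) - indYExt a t|]
  refine (Finset.sum_le_sum fun i _ => hstep i).trans ?_
  rw [Finset.sum_add_distrib]
  linarith

/-- The profile in which exactly the agents `0, …, b - 1` play `y`. -/
def blockProfile (n b : ℕ) : Profile n := fun i => if (i : ℕ) < b then .y else .x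

theorem IsConnectedRing.discord_blockProfile_le {G : SimpleGraph (Fin n)}
    (hG : IsConnectedRing k G) (hn : 2 * k < n) (b : ℕ) :
    discord G (blockProfile n b) ≤ 8 * k ^ 2 := by
  classical
  -- Only agents within distance k of an end of the block, at `b` or at the wrap-around, can have a
  -- discordant neighbour: at most 4k agents, each of degree 2k.
  set bad : Finset ℕ := Finset.range k ∪ Finset.Ico (b - k) (b + k) ∪ Finset.Ico (n - k) n
    with hbad
  have hcard : bad.card ≤ 4 * k := by
    refine (Finset.card_union_le _ _).trans ?_
    have := Finset.card_union_le (Finset.range k) (Finset.Ico (b - k) (b + k))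
    simp only [Finset.card_range, Nat.card_Ico] at this ⊢
    omega
  have hrow : ∀ i : Fin n, ∑ j, (if G.Adj i j ∧ blockProfile n b i ≠ blockProfile n b j
      then (1 : ℝ) else 0) ≤ if (i : ℕ) ∈ bad then 2 * (k : ℝ) else 0 := by
    intro i
    split_ifs with hi
    · calc _ ≤ ∑ j, (if G.Adj i j then (1 : ℝ) else 0) := by
            refine Finset.sum_le_sum fun j _ => ?_
            by_cases h : G.Adj i j <;> simp [h]
            split_ifs <;> norm_num
        _ = (G.neighborFinset i).card := by
            rw [Finset.sum_boole]
            congr 2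
            ext j
            simp
        _ ≤ _ := by rw [hG.card_neighborFinset hn]; push_cast; rfl
    · refine (Finset.sum_eq_zero fun j _ => if_neg ?_).le
      rintro ⟨hadj, hne⟩
      obtain ⟨d, h1, h2, h3⟩ := (hG.adj_iff i j).1 hadj
      simp only [hbad, Finset.mem_union, Finset.mem_range, Finset.mem_Ico, not_or] at hi
      have := add_mod_cases i.2 (by omega : d < n)
      have := add_mod_cases j.2 (by omega : d < n)
      have : ((i : ℕ) < b ↔ (j : ℕ) < b) := by omega
      apply hne
      simp only [blockProfile, this]
  refine (Finset.sum_le_sum fun i _ => hrow i).trans ?_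
  rw [← Finset.sum_range fun t => if t ∈ bad then 2 * (k : ℝ) else 0, ← Finset.sum_filter,
    Finset.sum_const, nsmul_eq_mul]
  have h : ((Finset.range n).filter (· ∈ bad)).card ≤ 4 * k :=
    (Finset.card_le_card fun t ht => (Finset.mem_filter.1 ht).2).trans hcard
  have h' : (((Finset.range n).filter (· ∈ bad)).card : ℝ) ≤ 4 * k := by exact_mod_cast h
  nlinarith [Nat.cast_nonneg (α := ℝ) k]

end Ring

/-! ### Evenly spread sets and the placement of adversaries -/

theorem sum_mul_sub_le {y g : ℕ → ℝ} (hy0 : ∀ t, 0 ≤ y t) (hy1 : ∀ t, y t ≤ 1)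
    (hg : ∀ t, |g t| ≤ 1 / 2) (N : ℕ) :
    ∑ t ∈ Finset.range N, y t * (g t - g (t + 1)) ≤
      (∑ t ∈ Finset.range N, |y (t + 1) - y t|) / 2 + 1 := by
  -- Summation by parts moves the differences onto `y`, so the sum costs one half per unit of
  -- variation plus one half at each end.
  have habel : ∀ N, ∑ t ∈ Finset.range N, y t * (g t - g (t + 1)) =
      y 0 * g 0 - y N * g N + ∑ t ∈ Finset.range N, (y (t + 1) - y t) * g (t + 1) := by
    intro N
    induction N with
    | zero => simp
    | succ N ih => rw [Finset.sum_range_succ, ih, Finset.sum_range_succ]; ring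
  have hend : ∀ t, |y t * g t| ≤ 1 / 2 := fun t => by
    rw [abs_mul, abs_of_nonneg (hy0 t)]
    nlinarith [hy0 t, hy1 t, hg t, abs_nonneg (g t)]
  have hsum : ∑ t ∈ Finset.range N, (y (t + 1) - y t) * g (t + 1) ≤
      (∑ t ∈ Finset.range N, |y (t + 1) - y t|) / 2 := by
    rw [Finset.sum_div]
    refine Finset.sum_le_sum fun t _ => (le_abs_self _).trans ?_
    rw [abs_mul]
    nlinarith [abs_nonneg (y (t + 1) - y t), hg (t + 1)]
  rw [habel]
  have h0 := abs_le.1 (hend 0)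
  have hN := abs_le.1 (hend N)
  linarith [h0.2, hN.1]

/-- An evenly spread set: `m` points among `N`, so that a union of intervals contains at most the
proportional number of them, up to a bounded error for each end of an interval. -/
theorem exists_evenly_spread {N m : ℕ} (hm : m ≤ N) : ∃ T : Finset ℕ, T ⊆ Finset.range N ∧
    T.card = m ∧ ∀ y : ℕ → ℝ, (∀ t, 0 ≤ y t) → (∀ t, y t ≤ 1) →
      ∑ t ∈ T, y t ≤ m / N * ∑ t ∈ Finset.range N, y t +
        (∑ t ∈ Finset.range N, |y (t + 1) - y t|) / 2 + 1 := by
  rcases Nat.eq_zero_or_pos N with rfl | hN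
  · obtain rfl : m = 0 := by omega
    exact ⟨∅, by simp, by simp, fun y _ _ => by simp⟩
  -- The chosen points are those where the floor of tm/N jumps; it jumps by at most one since m ≤ N.
  -- The function `g` is the fractional part of tm/N, centred so that |g| ≤ 1/2, and the indicator
  -- of a jump is m/N plus the telescoping difference of `g`.
  set q : ℕ → ℕ := fun t => t * m / N with hq
  set g : ℕ → ℝ := fun t => ((t * m % N : ℕ) : ℝ) / N - 1 / 2 with hg
  have hNR : (0 : ℝ) < N := by positivity
  have hstep : ∀ t, q t ≤ q (t + 1) ∧ q (t + 1) ≤ q t + 1 := fun t => by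
    simp only [hq]
    constructor
    · exact Nat.div_le_div_right (by nlinarith)
    · rw [← Nat.add_div_right _ hN]
      exact Nat.div_le_div_right (by nlinarith)
  have hqg : ∀ t : ℕ, (q t : ℝ) = t * (m / N : ℝ) - g t - 1 / 2 := fun t => by
    have h : ((N * (t * m / N) + t * m % N : ℕ) : ℝ) = (t * m : ℕ) := by rw [Nat.div_add_mod]
    simp only [hq, hg]
    rw [Nat.cast_add, Nat.cast_mul, Nat.cast_mul] at h
    field_simp
    linarith
  have hind : ∀ t, (if q t < q (t + 1) then (1 : ℝ) else 0) = m / N + (g t - g (t + 1)) := by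
    intro t
    have h1 : (if q t < q (t + 1) then (1 : ℝ) else 0) = (q (t + 1) : ℝ) - q t := by
      split_ifs with h
      · have : q (t + 1) = q t + 1 := by have := hstep t; omega
        rw [this]; push_cast; ring
      · have : q (t + 1) = q t := by have := hstep t; omega
        rw [this]; ring
    rw [h1, hqg, hqg]
    push_cast
    ring
  have hg2 : ∀ t, |g t| ≤ 1 / 2 := fun t => by
    have h1 : ((t * m % N : ℕ) : ℝ) / N ≤ 1 := by
      rw [div_le_one hNR]
      exact_mod_cast (Nat.mod_lt _ hN).le
    have h2 : 0 ≤ ((t * m % N : ℕ) : ℝ) / N := by positivity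
    rw [abs_le]
    constructor <;> simp only [hg] <;> linarith
  refine ⟨(Finset.range N).filter fun t => q t < q (t + 1), Finset.filter_subset _ _, ?_, ?_⟩
  · have h : (((Finset.range N).filter fun t => q t < q (t + 1)).card : ℝ) = m := by
      rw [← Finset.sum_boole]
      simp_rw [hind]
      rw [Finset.sum_add_distrib, Finset.sum_range_sub']
      simp [hg]
      field_simp
    exact_mod_cast h
  · intro y hy0 hy1
    rw [Finset.sum_filter]
    have h : ∀ t, (if q t < q (t + 1) then y t else 0) = m / N * y t + y t * (g t - g (t + 1)) := by
      intro t
      have := hind t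
      split_ifs at this ⊢ <;> linear_combination y t * this
    simp_rw [h]
    rw [Finset.sum_add_distrib, ← Finset.mul_sum]
    linarith [sum_mul_sub_le hy0 hy1 hg2 N]

/-- A placement of `b + m` adversaries promoting `y` and `nx` promoting `x`: the first `b` agents
are all influenced by `y`, and the other `m` adversaries promoting `y` are evenly spread. -/
theorem exists_placement {n b m nx : ℕ} (h : b + m + nx ≤ n) :
    ∃ Sx Sy : Finset (Fin n), Disjoint Sx Sy ∧ Sx.card = nx ∧ Sy.card = b + m ∧
      (∀ i : Fin n, (i : ℕ) < b → i ∈ Sy) ∧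
      ∀ y : ℕ → ℝ, (∀ t, 0 ≤ y t) → (∀ t, y t ≤ 1) →
        ∑ i ∈ Sy, y i ≤ ∑ t ∈ Finset.range b, y t +
          (m / (n - b : ℕ) * (∑ t ∈ Finset.range n, y t - ∑ t ∈ Finset.range b, y t) +
            (∑ t ∈ Finset.range n, |y (t + 1) - y t|) / 2 + 1) := by
  classical
  obtain ⟨T, hT, hTc, hTs⟩ := exists_evenly_spread (N := n - b) (m := m) (by omega)
  set P : ℕ → Prop := fun t => t < b ∨ (b ≤ t ∧ t - b ∈ T) with hP
  set Sy : Finset (Fin n) := Finset.univ.filter fun i => P i with hSy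
  have hsum : ∀ y : ℕ → ℝ, ∑ i ∈ Sy, y i =
      ∑ t ∈ Finset.range b, y t + ∑ t ∈ T, y (b + t) := by
    intro y
    rw [hSy, Finset.sum_filter, ← Finset.sum_range fun t => if P t then y t else 0]
    have hn : n = b + (n - b) := by omega
    conv_lhs => rw [hn]
    rw [Finset.sum_range_add]
    congr 1
    · refine Finset.sum_congr rfl fun t ht => if_pos (.inl (Finset.mem_range.1 ht))
    · have : ∀ t, P (b + t) ↔ t ∈ T := fun t => by simp [hP]
      simp_rw [this]
      rw [Finset.sum_ite_mem, Finset.inter_eq_right.2 hT]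
  have hcard : Sy.card = b + m := by
    have h1 := hsum fun _ => 1
    simp only [Finset.sum_const, nsmul_eq_mul, mul_one, Finset.card_range, hTc] at h1
    exact_mod_cast h1
  obtain ⟨Sx, hSx, hSxc⟩ := Finset.exists_subset_card_eq (s := Syᶜ) (n := nx) (by
    rw [Finset.card_compl, hcard, Fintype.card_fin]; omega)
  refine ⟨Sx, Sy, ?_, hSxc, hcard, ?_, ?_⟩
  · rw [Finset.disjoint_left]
    exact fun i hi => Finset.mem_compl.1 (hSx hi)
  · intro i hi
    simp [hSy, hP, hi]
  · intro y hy0 hy1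
    have h2 := hTs (fun t => y (b + t)) (fun t => hy0 _) fun t => hy1 _
    have hn : ∀ f : ℕ → ℝ, ∑ t ∈ Finset.range (n - b), f (b + t) =
        ∑ t ∈ Finset.range n, f t - ∑ t ∈ Finset.range b, f t := fun f => by
      have hn : n = b + (n - b) := by omega
      conv_rhs => rw [hn]
      rw [Finset.sum_range_add]
      simp
    have h4 := hn fun t => |y (t + 1) - y t|
    simp only [← add_assoc] at h2 h4
    rw [hn y, h4] at h2
    rw [hsum]
    have h3 : 0 ≤ ∑ t ∈ Finset.range b, |y (t + 1) - y t| :=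
      Finset.sum_nonneg fun _ _ => abs_nonneg _
    linarith

/-! ### Bounding efficiencies through potential maximizers -/

section Efficiency

variable {n : ℕ} (G : SimpleGraph (Fin n)) (α : ℝ)

theorem linkBenefit_nonneg {α : ℝ} (hα : 0 ≤ α) (c d : Convention) : 0 ≤ linkBenefit α c d := by
  cases c <;> cases d <;> simp [linkBenefit]; linarith

theorem welfare_nonneg (hα : 0 ≤ α) (a : Profile n) : 0 ≤ welfare G α a :=
  Finset.sum_nonneg fun _ _ => Finset.sum_nonneg fun _ _ => linkBenefit_nonneg hα _ _

theorem efficiency_nonneg (hα : 0 ≤ α) (Sx Sy : Finset (Fin n)) : 0 ≤ efficiency G α Sx Sy := by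
  refine Real.sInf_nonneg ?_
  rintro _ ⟨a, -, rfl⟩
  exact div_nonneg (welfare_nonneg G α hα a) (Real.iSup_nonneg (welfare_nonneg G α hα))

theorem le_efficiency (hn : 0 < n) {c : ℝ} {Sx Sy : Finset (Fin n)}
    (h : ∀ a, (∀ b, potential G α Sx Sy b ≤ potential G α Sx Sy a) →
      c ≤ welfare G α a / optWelfare G α) : c ≤ efficiency G α Sx Sy := by
  obtain ⟨m, hm⟩ := exists_forall_potential_le G α Sx Sy
  refine le_csInf ⟨_, m, (mem_stochasticallyStable_iff G α Sx Sy hn m).2 hm, rfl⟩ ?_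
  rintro _ ⟨a, ha, rfl⟩
  exact h a ((mem_stochasticallyStable_iff G α Sx Sy hn a).1 ha)

theorem efficiency_le (hn : 0 < n) {c : ℝ} {Sx Sy : Finset (Fin n)} (a : Profile n)
    (ha : ∀ b, potential G α Sx Sy b ≤ potential G α Sx Sy a)
    (hc : welfare G α a / optWelfare G α ≤ c) : efficiency G α Sx Sy ≤ c :=
  (csInf_le (Set.toFinite _).bddBelow (Set.mem_image_of_mem _
    ((mem_stochasticallyStable_iff G α Sx Sy hn a).2 ha))).trans hc

theorem efficiency_le_uninformedEfficiency {Sx Sy : Finset (Fin n)} (hd : Disjoint Sx Sy) :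
    efficiency G α Sx Sy ≤ uninformedEfficiency G α Sx.card Sy.card := by
  refine le_csSup ?_ ⟨Sx, Sy, hd, rfl, rfl, rfl⟩
  refine ((Set.finite_range fun p : Finset (Fin n) × Finset (Fin n) =>
    efficiency G α p.1 p.2).subset ?_).bddAbove
  rintro _ ⟨Sx, Sy, -, -, -, rfl⟩
  exact ⟨(Sx, Sy), rfl⟩

theorem uninformedEfficiency_le {c : ℝ} {ny : ℕ} (hny : ny ≤ n)
    (h : ∀ Sy : Finset (Fin n), Sy.card = ny → efficiency G α ∅ Sy ≤ c) :
    uninformedEfficiency G α 0 ny ≤ c := by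
  obtain ⟨Sy, -, hSy⟩ := Finset.exists_subset_card_eq (s := (Finset.univ : Finset (Fin n)))
    (n := ny) (by simpa using hny)
  refine csSup_le ⟨_, ∅, Sy, Finset.disjoint_empty_left _, rfl, hSy, rfl⟩ ?_
  rintro _ ⟨Sx, Sy, -, hx, hy, rfl⟩
  rw [Finset.card_eq_zero.1 hx]
  exact h Sy hy

end Efficiency

/-! ### Upper and lower bounds on the worst-case efficiency -/

section WorstCase

variable {n k : ℕ} {α γ : ℝ}

theorem le_worstCaseEfficiency (hn : 2 * k < n) (hγ : 0 ≤ γ) {c : ℝ}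
    (h : ∀ G : SimpleGraph (Fin n), IsConnectedRing k G → ∀ nx ny : ℕ,
      ((nx + ny : ℕ) : ℝ) ≤ γ * n → c ≤ uninformedEfficiency G α nx ny) :
    c ≤ worstCaseEfficiency k α γ n := by
  obtain ⟨G, hG⟩ := exists_isConnectedRing hn
  -- The policy without adversaries shows that the infimum is over a nonempty set.
  refine le_csInf ⟨_, G, hG, 0, 0, ?_, rfl⟩ ?_
  · simpa using mul_nonneg hγ (Nat.cast_nonneg n)
  · rintro _ ⟨G, hG, nx, ny, hxy, rfl⟩
    exact h G hG nx ny hxy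

theorem worstCaseEfficiency_le (hn : 2 * k < n) (hα : 0 ≤ α) (hγ : γ ≤ 1) {c : ℝ} {ny : ℕ}
    (hny : (ny : ℝ) ≤ γ * n)
    (h : ∀ G : SimpleGraph (Fin n), IsConnectedRing k G → ∀ Sy : Finset (Fin n), Sy.card = ny →
      ∃ a, (∀ b, potential G α ∅ Sy b ≤ potential G α ∅ Sy a) ∧
        welfare G α a / optWelfare G α ≤ c) :
    worstCaseEfficiency k α γ n ≤ c := by
  obtain ⟨G, hG⟩ := exists_isConnectedRing hn
  have hle : uninformedEfficiency G α 0 ny ≤ c := by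
    refine uninformedEfficiency_le G α ?_ fun Sy hSy => ?_
    · have : (ny : ℝ) ≤ n := by nlinarith [Nat.cast_nonneg (α := ℝ) n]
      exact_mod_cast this
    · obtain ⟨a, ha, hc⟩ := h G hG Sy hSy
      exact efficiency_le G α (by omega) a ha hc
  have hmem : uninformedEfficiency G α 0 ny ∈ {r | ∃ G : SimpleGraph (Fin n),
      IsConnectedRing k G ∧ ∃ nx ny : ℕ, ((nx + ny : ℕ) : ℝ) ≤ γ * n ∧
        r = uninformedEfficiency G α nx ny} := ⟨G, hG, 0, ny, by simpa using hny, rfl⟩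
  refine (csInf_le ⟨0, ?_⟩ hmem).trans hle
  rintro _ ⟨G, -, nx, ny, -, rfl⟩
  refine Real.sSup_nonneg ?_
  rintro _ ⟨Sx, Sy, -, -, -, rfl⟩
  exact efficiency_nonneg G α hα Sx Sy

open scoped Classical in
theorem IsConnectedRing.welfare_ratio_le {G : SimpleGraph (Fin n)} (hG : IsConnectedRing k G)
    (hk : 1 ≤ k) (hn : 2 * k < n) (hα : 0 ≤ α) (a : Profile n) :
    welfare G α a / optWelfare G α ≤ 1 - α / (1 + α) * (numY a / n) := by
  rw [welfare_div_optWelfare G α hα (by omega) (by omega : 0 < 2 * k) (hG.card_neighborFinset hn)]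
  have h : 0 ≤ (1 + α / 2) * discord G a / ((2 * k : ℕ) * n * (1 + α)) :=
    div_nonneg (mul_nonneg (by linarith) (discord_nonneg G a)) (by positivity)
  linarith

theorem numY_const_y : numY (fun _ : Fin n => Convention.y) = n := by
  simp [numY, Convention.indY]

theorem sum_indY_le_numY (S : Finset (Fin n)) (a : Profile n) :
    ∑ i ∈ S, (a i).indY ≤ numY a :=
  Finset.sum_le_sum_of_subset_of_nonneg (Finset.subset_univ S)
    fun _ _ _ => Convention.indY_nonneg _

theorem numY_eq_sum_range (a : Profile n) : numY a = ∑ t ∈ Finset.range n, indYExt a t := by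
  rw [Finset.sum_range]
  simp_rw [indYExt_coe]
  rfl

theorem numY_blockProfile {b : ℕ} (hb : b ≤ n) : numY (blockProfile n b) = b := by
  have h : ∀ i : Fin n, (blockProfile n b i).indY = if (i : ℕ) < b then (1 : ℝ) else 0 := by
    intro i
    unfold blockProfile
    split_ifs <;> rfl
  simp_rw [numY, h]
  rw [← Finset.sum_range fun t => if t < b then (1 : ℝ) else 0, Finset.sum_boole]
  congr 1
  have : (Finset.range n).filter (· < b) = Finset.range b := by
    ext t
    simp
    omega
  rw [this, Finset.card_range]

theorem worstCaseEfficiency_le_one (hk : 1 ≤ k) (hn : 2 * k < n) (hα : 0 ≤ α) (hγ0 : 0 ≤ γ)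
    (hγ : γ ≤ 1) : worstCaseEfficiency k α γ n ≤ 1 := by
  refine worstCaseEfficiency_le (ny := 0) hn hα hγ (by simp; positivity) fun G hG Sy _ => ?_
  obtain ⟨a, ha⟩ := exists_forall_potential_le G α ∅ Sy
  refine ⟨a, ha, (hG.welfare_ratio_le hk hn hα a).trans ?_⟩
  have : 0 ≤ α / (1 + α) * (numY a / n) :=
    mul_nonneg (by positivity) (div_nonneg (numY_nonneg a) (Nat.cast_nonneg n))
  linarith

theorem div_one_add_le_one (hα : 0 ≤ α) : α / (1 + α) ≤ 1 := by
  rw [div_le_one (by linarith)]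
  linarith

/-- Spend the whole budget on y. A maximizer is at least as good as all-y and gains at most one per
y-player from the adversaries, which forces many y-players regardless of the placement. The 1/n term
comes from rounding γn down. -/
theorem worstCaseEfficiency_le_of_lt_one (hk : 1 ≤ k) (hn : 2 * k < n) (hα : 0 ≤ α) (hγ0 : 0 ≤ γ)
    (hγ : γ ≤ 1) (hlt : k * α < 1) :
    worstCaseEfficiency k α γ n ≤
      1 - α / (1 + α) * ((γ - k * α) / (1 - k * α)) + 1 / (1 - k * α) / n := by
  have hpos : (0 : ℝ) < n := by exact_mod_cast (by omega : 0 < n)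
  refine worstCaseEfficiency_le (ny := ⌊γ * n⌋₊) hn hα hγ (Nat.floor_le (by positivity))
    fun G hG Sy hSy => ?_
  obtain ⟨a, ha⟩ := exists_forall_potential_le G α ∅ Sy
  refine ⟨a, ha, (hG.welfare_ratio_le hk hn hα a).trans ?_⟩
  have h := ha fun _ => .y
  rw [potential_eq G α ∅ Sy (hG.card_neighborFinset hn) (Finset.disjoint_empty_left _),
    potential_eq G α ∅ Sy (hG.card_neighborFinset hn) (Finset.disjoint_empty_left _),
    discord_const, numY_const_y] at h
  simp [Convention.indY, hSy] at h
  have hD := mul_nonneg (by linarith : 0 ≤ 1 + α / 2) (discord_nonneg G a)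
  have hS := sum_indY_le_numY Sy a
  have hfl := (Nat.lt_floor_add_one (γ * n)).le
  have h1 : (γ - k * α) * n - 1 ≤ (1 - k * α) * numY a := by
    simp only [Convention.indY] at hS
    linarith
  have h2 : (γ - k * α) / (1 - k * α) - 1 / (1 - k * α) / n ≤ numY a / n := by
    have h0 : 0 < 1 - k * α := by linarith
    rw [div_div, div_sub_div _ _ h0.ne' (by positivity), div_le_div_iff₀ (by positivity) hpos]
    nlinarith [mul_pos h0 hpos, mul_le_mul_of_nonneg_left h1 (mul_pos h0 hpos).le]
  have h3 : 0 ≤ α / (1 + α) := by positivity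
  have h4 := mul_le_mul_of_nonneg_left h2 h3
  have h5 : α / (1 + α) * (1 / (1 - k * α) / n) ≤ 1 / (1 - k * α) / n :=
    mul_le_of_le_one_left (div_nonneg (one_div_nonneg.2 (by linarith)) hpos.le)
      (div_one_add_le_one hα)
  linarith

/-- When kα = 1 the counting bound degenerates. With every agent influenced by y, however, the terms
in `numY` cancel and only the discord penalty remains, so all-y is among the maximizers, and
efficiency takes the worst one. -/
theorem worstCaseEfficiency_le_of_eq_one (hk : 1 ≤ k) (hn : 2 * k < n) (hα : 0 ≤ α)
    (h1 : k * α = 1) : worstCaseEfficiency k α 1 n ≤ 1 - α / (1 + α) := by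
  have hpos : (0 : ℝ) < n := by exact_mod_cast (by omega : 0 < n)
  refine worstCaseEfficiency_le (ny := n) hn hα le_rfl (by simp) fun G hG Sy hSy => ?_
  obtain rfl : Sy = Finset.univ := (Finset.card_eq_iff_eq_univ Sy).1 (by simpa using hSy)
  refine ⟨fun _ => .y, fun a => ?_, (hG.welfare_ratio_le hk hn hα _).trans ?_⟩
  · rw [potential_eq G α ∅ _ (hG.card_neighborFinset hn) (Finset.disjoint_empty_left _),
      potential_eq G α ∅ _ (hG.card_neighborFinset hn) (Finset.disjoint_empty_left _),
      discord_const, numY_const_y]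
    have hD := mul_nonneg (by linarith : 0 ≤ 1 + α / 2) (discord_nonneg G a)
    have e1 : ∑ i, (a i).indY = numY a := rfl
    have e2 : ∀ z : ℝ, α * (2 * k : ℕ) * z = 2 * z := fun z => by
      push_cast
      linear_combination 2 * z * h1
    rw [e1, e2, e2]
    simp [Convention.indY]
    linarith
  · rw [numY_const_y, div_self hpos.ne', mul_one]

/-- The constant in the lower bound on the efficiency. -/
noncomputable def ringConst (k : ℕ) (α : ℝ) : ℝ := 2 + (1 + α / 2) * (4 * k ^ 2)

/-- A maximizer is compared with `blockProfile n b`. Outside the block the adversarial gain per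
y-player falls short of its cost kα by the fraction δ, up to boundary errors dominated by the
discord penalty. Inside the block, abandoning y does not pay when kα ≤ 1, and there is no block
otherwise. -/
theorem IsConnectedRing.le_uninformedEfficiency {G : SimpleGraph (Fin n)}
    (hG : IsConnectedRing k G) (hk : 1 ≤ k) (hn : 2 * k < n) (hα : 0 ≤ α) {b m nx : ℕ}
    {δ : ℝ} (hδ : 0 < δ) (hbm : b + m + nx ≤ n)
    (hm : (m : ℝ) ≤ k * α * (1 - δ) * (n - b)) (hb : k * α ≤ 1 ∨ b = 0) :
    1 - α / (1 + α) * (b / n) - (ringConst k α / δ + 4 * ringConst k α) / n ≤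
      uninformedEfficiency G α nx (b + m) := by
  have hpos : (0 : ℝ) < n := by exact_mod_cast (by omega : 0 < n)
  have hk1 : (1 : ℝ) ≤ k := by exact_mod_cast hk
  obtain ⟨Sx, Sy, hd, hx, hy, hblock, hspread⟩ := exists_placement hbm
  rw [← hx, ← hy]
  refine le_trans ?_ (efficiency_le_uninformedEfficiency G α hd)
  refine le_efficiency G α (by omega) fun a ha => ?_
  rw [welfare_div_optWelfare G α hα (by omega) (by omega : 0 < 2 * k) (hG.card_neighborFinset hn)]
  have hmax := ha (blockProfile n b)
  rw [potential_eq G α Sx Sy (hG.card_neighborFinset hn) hd,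
    potential_eq G α Sx Sy (hG.card_neighborFinset hn) hd, numY_blockProfile (by omega)] at hmax
  have hSx : ∑ i ∈ Sx, (blockProfile n b i).indY = 0 := by
    refine Finset.sum_eq_zero fun i hi => ?_
    have : ¬ (i : ℕ) < b := fun h => Finset.disjoint_left.1 hd hi (hblock i h)
    simp [blockProfile, this, Convention.indY]
  have hSy : ∑ i ∈ Sy, (blockProfile n b i).indY = b := by
    rw [← numY_blockProfile (n := n) (b := b) (by omega), numY]
    refine Finset.sum_subset (Finset.subset_univ _) fun i _ hi => ?_
    have : ¬ (i : ℕ) < b := fun h => hi (hblock i h)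
    simp [blockProfile, this, Convention.indY]
  have hs := hspread (indYExt a) (indYExt_nonneg a) (indYExt_le_one a)
  simp_rw [indYExt_coe] at hs
  rw [← numY_eq_sum_range] at hs
  set Y := numY a
  set B := ∑ t ∈ Finset.range b, indYExt a t with hB
  set D := discord G a
  have hcut := hG.sum_abs_le_discord hk hn a
  have hDb := hG.discord_blockProfile_le hn b
  have hD : 0 ≤ D := discord_nonneg G a
  have hSxa : 0 ≤ ∑ i ∈ Sx, (a i).indY := Finset.sum_nonneg fun _ _ => Convention.indY_nonneg _
  have hBb : B ≤ b := by
    refine (Finset.sum_le_sum fun t _ => indYExt_le_one a t).trans ?_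
    simp
  have hBY : B ≤ Y := by
    rw [show Y = ∑ t ∈ Finset.range n, indYExt a t from numY_eq_sum_range a]
    exact Finset.sum_le_sum_of_subset_of_nonneg (Finset.range_subset_range.2 (by omega))
      fun _ _ _ => indYExt_nonneg a _
  -- If the block is the whole ring, the density is a division by zero, but then there are no agents
  -- outside and Y = B.
  have hdens : (m : ℝ) / (n - b : ℕ) * (Y - B) ≤ k * α * (1 - δ) * (Y - B) := by
    rcases Nat.eq_zero_or_pos (n - b) with h0 | h0
    · have hYn : Y ≤ B := by
        rw [show Y = ∑ t ∈ Finset.range n, indYExt a t from numY_eq_sum_range a, hB]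
        exact Finset.sum_le_sum_of_subset_of_nonneg (Finset.range_subset_range.2 (by omega))
          fun _ _ _ => indYExt_nonneg a _
      rw [le_antisymm hYn hBY]
      simp
    · refine mul_le_mul_of_nonneg_right ?_ (sub_nonneg.2 hBY)
      rw [div_le_iff₀ (by exact_mod_cast h0), Nat.cast_sub (by omega)]
      exact hm
  have hblockterm : 0 ≤ (1 - k * α) * (b - B) := by
    rcases hb with h | h
    · exact mul_nonneg (by linarith) (by linarith)
    · subst h
      simp [hB]
  have hDb' : (1 + α / 2) * discord G (blockProfile n b) ≤ (1 + α / 2) * (8 * k ^ 2) :=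
    mul_le_mul_of_nonneg_left hDb (by linarith)
  have hSxa' : 0 ≤ (1 + α) * ∑ i ∈ Sx, (a i).indY := mul_nonneg (by linarith) hSxa
  have hαD : 0 ≤ α * D := mul_nonneg hα hD
  rw [hSx, hSy] at hmax
  push_cast at hmax
  -- The discord penalty is at least D/2, while the spreading error is (D/2 + 1)/2 + 1; this leaves
  -- D/4 on the left. The constant absorbs the remaining 3/2 and the penalty (1+α/2)·4k² of the
  -- block profile. All three terms on the left are nonnegative, so each is bounded separately.
  have key : (1 - k * α) * (b - B) + k * α * δ * (Y - B) + D / 4 ≤ ringConst k α := by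
    unfold ringConst
    linarith
  have hE0 : 0 ≤ α * δ * (Y - B) := mul_nonneg (mul_nonneg hα hδ.le) (by linarith)
  have hE1 : α * δ * (Y - B) ≤ k * α * δ * (Y - B) := by
    have := le_mul_of_one_le_left hE0 hk1
    linarith
  have hC1 : α * (Y - B) ≤ ringConst k α / δ := by
    rw [le_div_iff₀ hδ]
    linarith
  have hC2 : D ≤ 4 * ringConst k α := by linarith
  have hCnn : 0 ≤ ringConst k α := by linarith
  have h1α : 0 < 1 + α := by linarith
  have hF1 : α / (1 + α) * (Y / n) ≤ α / (1 + α) * (b / n) + ringConst k α / δ / n := by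
    rw [div_mul_div_comm, div_mul_div_comm, ← sub_le_iff_le_add', ← sub_div, ← mul_sub,
      div_le_div_iff₀ (by positivity) hpos]
    have h3 : α * (Y - b) ≤ ringConst k α / δ :=
      (mul_le_mul_of_nonneg_left (by linarith) hα).trans hC1
    have h4 : 0 ≤ ringConst k α / δ := by positivity
    calc α * (Y - b) * n ≤ ringConst k α / δ * n := mul_le_mul_of_nonneg_right h3 hpos.le
      _ ≤ ringConst k α / δ * ((1 + α) * n) :=
        mul_le_mul_of_nonneg_left (le_mul_of_one_le_left hpos.le (by linarith)) h4
  have hF2 : (1 + α / 2) * D / ((2 * k : ℕ) * n * (1 + α)) ≤ 4 * ringConst k α / n := by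
    rw [div_le_div_iff₀ (by positivity) hpos]
    push_cast
    have h5 : (1 + α / 2) * n ≤ 2 * k * n * (1 + α) := by
      have h6 := mul_le_mul_of_nonneg_right hk1 h1α.le
      calc (1 + α / 2) * n ≤ 2 * k * (1 + α) * n :=
            mul_le_mul_of_nonneg_right (by linarith) hpos.le
        _ = _ := by ring
    calc (1 + α / 2) * D * n = D * ((1 + α / 2) * n) := by ring
      _ ≤ 4 * ringConst k α * (2 * k * n * (1 + α)) :=
        mul_le_mul hC2 h5 (by positivity) (by linarith)
  rw [add_div]
  linarith

/-- Below the threshold no block is needed: all y-adversaries are spread evenly, and kα may exceed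
1. -/
theorem le_worstCaseEfficiency_of_le (hk : 1 ≤ k) (hn : 2 * k < n) (hα : 0 ≤ α) (hγ0 : 0 ≤ γ)
    (hγ1 : γ ≤ 1) {δ : ℝ} (hδ : 0 < δ) (hd : γ ≤ k * α * (1 - δ)) :
    1 - (ringConst k α / δ + 4 * ringConst k α) / n ≤ worstCaseEfficiency k α γ n := by
  refine le_worstCaseEfficiency hn hγ0 fun G hG nx ny hxy => ?_
  have hnn : (0 : ℝ) ≤ n := Nat.cast_nonneg n
  push_cast at hxy
  have hx : (0 : ℝ) ≤ nx := Nat.cast_nonneg nx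
  have hle : 0 + ny + nx ≤ n := by
    have : (ny : ℝ) + nx ≤ n := by nlinarith
    rw [zero_add]
    exact_mod_cast this
  have h := hG.le_uninformedEfficiency hk hn hα hδ hle (by push_cast; nlinarith) (.inr rfl)
  simpa using h

theorem le_worstCaseEfficiency_of_lt_one (hk : 1 ≤ k) (hn : 2 * k < n) (hα : 0 ≤ α)
    (hγ0 : 0 ≤ γ) (hγ1 : γ ≤ 1) (hkα : k * α ≤ 1) {δ d : ℝ} (hδ : 0 < δ)
    (hd : d = k * α * (1 - δ)) (hd0 : 0 ≤ d) (hd1 : d < 1) (hdγ : d ≤ γ) :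
    1 - α / (1 + α) * ((γ - d) / (1 - d)) - (ringConst k α / δ + 4 * ringConst k α + 1) / n ≤
      worstCaseEfficiency k α γ n := by
  refine le_worstCaseEfficiency hn hγ0 fun G hG nx ny hxy => ?_
  have hpos : (0 : ℝ) < n := by exact_mod_cast (by omega : 0 < n)
  have h1d : 0 < 1 - d := by linarith
  push_cast at hxy
  have hx : (0 : ℝ) ≤ nx := Nat.cast_nonneg nx
  have hγn : γ * n ≤ n := mul_le_of_le_one_left hpos.le hγ1
  have hxyn : ny + nx ≤ n := by
    have : (ny : ℝ) + nx ≤ n := by linarith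
    exact_mod_cast this
  have hyn : (ny : ℝ) ≤ n := by linarith
  -- The least block size for which the remaining ny - b adversaries have density at most d among
  -- the other n - b agents. It is 0 when ny ≤ dn.
  set b := ⌈(ny - d * n) / (1 - d)⌉₊ with hb
  have hby : b ≤ ny := by
    rw [hb, Nat.ceil_le, div_le_iff₀ h1d]
    linarith [mul_le_mul_of_nonneg_left hyn hd0]
  have hbr : (ny - d * n) ≤ b * (1 - d) := by
    rw [← div_le_iff₀ h1d]
    exact Nat.le_ceil _
  have hbn : (b : ℝ) ≤ (γ - d) / (1 - d) * n + 1 := by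
    have h1 : (0 : ℝ) ≤ (γ - d) / (1 - d) * n :=
      mul_nonneg (div_nonneg (by linarith) h1d.le) hpos.le
    have h2 : (ny - d * n) / (1 - d) ≤ (γ - d) / (1 - d) * n := by
      rw [div_mul_eq_mul_div]
      exact div_le_div_of_nonneg_right (by linarith) h1d.le
    have h3 : (b : ℝ) ≤ ⌈(γ - d) / (1 - d) * n⌉₊ := by exact_mod_cast Nat.ceil_mono h2
    linarith [Nat.ceil_lt_add_one h1]
  have h := hG.le_uninformedEfficiency hk hn hα hδ (b := b) (m := ny - b) (nx := nx) (by omega)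
    (by rw [← hd, Nat.cast_sub hby]; linarith) (.inl hkα)
  rw [Nat.add_sub_cancel' hby] at h
  refine le_trans ?_ h
  have h4 : (b : ℝ) / n ≤ (γ - d) / (1 - d) + 1 / n := by
    rw [div_le_iff₀ hpos, add_mul, one_div_mul_cancel hpos.ne']
    exact hbn
  have h5 := mul_le_mul_of_nonneg_left h4 (by positivity : 0 ≤ α / (1 + α))
  have h6 : α / (1 + α) * (1 / n) ≤ 1 / n :=
    mul_le_of_le_one_left (by positivity) (div_one_add_le_one hα)
  rw [add_div _ (1 : ℝ)]
  linarith

end WorstCase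

/-! ### Passage to the limit and comparison with the minimally connected ring -/

section Limits

variable {k : ℕ} {α γ : ℝ}

theorem tendsto_sub_const_div (L C : ℝ) :
    Tendsto (fun n : ℕ => L - C / n) atTop (𝓝 L) := by
  simpa using tendsto_const_nhds.sub (tendsto_const_div_atTop_nhds_zero_nat C)

theorem tendsto_worstCaseEfficiency_of_lt (hk : 1 ≤ k) (hα : 0 ≤ α) (hγ0 : 0 ≤ γ)
    (hγ1 : γ ≤ 1) (h : γ < k * α) :
    Tendsto (worstCaseEfficiency k α γ) atTop (𝓝 1) := by
  have hpos : 0 < k * α := by linarith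
  set δ := 1 - γ / (k * α) with hδ
  have hδ0 : 0 < δ := by
    rw [hδ, sub_pos, div_lt_one hpos]
    exact h
  have hd : γ ≤ k * α * (1 - δ) := by
    rw [hδ, sub_sub_cancel, mul_div_cancel₀ _ hpos.ne']
  refine tendsto_of_tendsto_of_tendsto_of_le_of_le'
    (tendsto_sub_const_div 1 (ringConst k α / δ + 4 * ringConst k α)) tendsto_const_nhds ?_ ?_
  · filter_upwards [eventually_gt_atTop (2 * k)] with n hn
    exact le_worstCaseEfficiency_of_le hk hn hα hγ0 hγ1 hδ0 hd
  · filter_upwards [eventually_gt_atTop (2 * k)] with n hn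
    exact worstCaseEfficiency_le_one hk hn hα hγ0 hγ1

theorem tendsto_worstCaseEfficiency_of_lt_one (hk : 1 ≤ k) (hα : 0 ≤ α) (hγ0 : 0 ≤ γ)
    (hγ1 : γ ≤ 1) (h : k * α ≤ γ) (hlt : k * α < 1) :
    Tendsto (worstCaseEfficiency k α γ) atTop
      (𝓝 (1 - α / (1 + α) * ((γ - k * α) / (1 - k * α)))) := by
  have hkα0 : 0 ≤ k * α := by positivity
  refine tendsto_order.2 ⟨fun c hc => ?_, fun c hc => ?_⟩
  -- The error constant blows up as δ → 0, so δ is first fixed small enough that the limiting lower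
  -- bound exceeds `c`, and only then n → ∞.
  · have hcont : Tendsto (fun δ : ℝ => 1 - α / (1 + α) *
        ((γ - k * α * (1 - δ)) / (1 - k * α * (1 - δ)))) (𝓝[>] 0)
        (𝓝 (1 - α / (1 + α) * ((γ - k * α) / (1 - k * α)))) := by
      have : ContinuousAt (fun δ : ℝ => 1 - α / (1 + α) *
          ((γ - k * α * (1 - δ)) / (1 - k * α * (1 - δ)))) 0 := by
        refine continuousAt_const.sub (continuousAt_const.mul (ContinuousAt.div ?_ ?_ ?_))
        · fun_prop
        · fun_prop
        · simp only [sub_zero, mul_one]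
          linarith
      simpa using this.tendsto.mono_left (nhdsWithin_le_nhds (s := Set.Ioi 0))
    obtain ⟨δ, hδc, hδ0, hδ1⟩ := ((hcont.eventually_const_lt hc).and
      (Ioo_mem_nhdsGT (zero_lt_one' ℝ))).exists
    have hle : k * α * (1 - δ) ≤ k * α := mul_le_of_le_one_right hkα0 (by linarith)
    filter_upwards [eventually_gt_atTop (2 * k), (tendsto_sub_const_div _
      (ringConst k α / δ + 4 * ringConst k α + 1)).eventually_const_lt hδc] with n hn hcn
    exact hcn.trans_le (le_worstCaseEfficiency_of_lt_one hk hn hα hγ0 hγ1 hlt.le hδ0 rfl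
      (mul_nonneg hkα0 (by linarith)) (by linarith) (by linarith))
  · have hlim : Tendsto (fun n : ℕ => 1 - α / (1 + α) * ((γ - k * α) / (1 - k * α)) +
        1 / (1 - k * α) / n) atTop (𝓝 (1 - α / (1 + α) * ((γ - k * α) / (1 - k * α)))) := by
      simpa using tendsto_const_nhds.add
        (tendsto_const_div_atTop_nhds_zero_nat (1 / (1 - k * α)))
    filter_upwards [eventually_gt_atTop (2 * k), hlim.eventually_lt_const hc] with n hn hcn
    exact (worstCaseEfficiency_le_of_lt_one hk hn hα hγ0 hγ1 hlt).trans_lt hcn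

theorem tendsto_worstCaseEfficiency_of_eq_one (hk : 1 ≤ k) (hα : 0 ≤ α) (h : k * α = 1) :
    Tendsto (worstCaseEfficiency k α 1) atTop (𝓝 (1 - α / (1 + α))) := by
  refine tendsto_of_tendsto_of_tendsto_of_le_of_le'
    (tendsto_sub_const_div _ (ringConst k α / (1 / 2) + 4 * ringConst k α + 1))
    tendsto_const_nhds ?_ ?_
  · filter_upwards [eventually_gt_atTop (2 * k)] with n hn
    -- With γ = 1 the ratio (γ - d)/(1 - d) is 1 for every d < 1, so no limit in δ is needed and 1/2
    -- is an arbitrary choice.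
    have hh := le_worstCaseEfficiency_of_lt_one (γ := 1) (δ := 1 / 2) (d := 1 / 2) hk hn hα
      zero_le_one le_rfl h.le (by norm_num) (by rw [h]; norm_num) (by norm_num) (by norm_num)
      (by norm_num)
    rwa [div_self (by norm_num), mul_one] at hh
  · filter_upwards [eventually_gt_atTop (2 * k)] with n hn
    exact worstCaseEfficiency_le_of_eq_one hk hn hα h

/-- The limit of the worst-case efficiency exists, and is at least the corresponding limit for the
minimally connected ring. -/
theorem exists_tendsto_worstCaseEfficiency (hk : 1 ≤ k) (hα0 : 0 ≤ α) (hα1 : α < 1)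
    (hγ0 : 0 ≤ γ) (hγ1 : γ ≤ 1) :
    ∃ ℓ₁ ℓ : ℝ, Tendsto (worstCaseEfficiency 1 α γ) atTop (𝓝 ℓ₁) ∧
      Tendsto (worstCaseEfficiency k α γ) atTop (𝓝 ℓ) ∧ ℓ₁ ≤ ℓ := by
  have hk1 : (1 : ℝ) ≤ k := by exact_mod_cast hk
  have hαk : α ≤ k * α := le_mul_of_one_le_left hα0 hk1
  have hw : 0 ≤ α / (1 + α) := by positivity
  have hone : γ < α ∨ α ≤ γ := lt_or_ge γ α
  rcases lt_or_ge γ (k * α) with h | h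
  · have hk' := tendsto_worstCaseEfficiency_of_lt hk hα0 hγ0 hγ1 h
    rcases hone with h1 | h1
    · exact ⟨1, 1, tendsto_worstCaseEfficiency_of_lt le_rfl hα0 hγ0 hγ1 (by simpa using h1), hk',
        le_rfl⟩
    · refine ⟨_, 1, tendsto_worstCaseEfficiency_of_lt_one le_rfl hα0 hγ0 hγ1 (by simpa using h1)
        (by simpa using hα1), hk', ?_⟩
      have : 0 ≤ (γ - (1 : ℕ) * α) / (1 - (1 : ℕ) * α) :=
        div_nonneg (by simpa using h1) (by simpa using hα1.le)
      linarith [mul_nonneg hw this]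
  · have ht1 := tendsto_worstCaseEfficiency_of_lt_one (k := 1) le_rfl hα0 hγ0 hγ1
      (by simpa using hαk.trans h) (by simpa using hα1)
    simp only [Nat.cast_one, one_mul] at ht1
    rcases (h.trans hγ1).lt_or_eq with hlt | heq
    · refine ⟨_, _, ht1, tendsto_worstCaseEfficiency_of_lt_one hk hα0 hγ0 hγ1 h hlt, ?_⟩
      refine sub_le_sub_left (mul_le_mul_of_nonneg_left ?_ hw) _
      -- For γ ≤ 1 the map s ↦ (γ - s)/(1 - s) is nonincreasing on s < 1, and α ≤ kα.
      rw [div_le_div_iff₀ (by linarith) (by linarith)]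
      nlinarith
    -- Here kα = 1 forces γ = 1, and the two limits coincide.
    · obtain rfl : γ = 1 := le_antisymm hγ1 (heq ▸ h)
      refine ⟨_, _, ht1, tendsto_worstCaseEfficiency_of_eq_one hk hα0 heq, ?_⟩
      rw [div_self (by linarith), mul_one]

end Limits

end CoordinationGame

theorem mainTheorem1 (k : ℕ) (hk : 1 ≤ k) (α γ : ℝ) (hα0 : 0 ≤ α) (hα1 : α < 1)
    (hγ0 : 0 ≤ γ) (hγ1 : γ ≤ 1) :
    (γ < k * α →
      Tendsto (CoordinationGame.worstCaseEfficiency k α γ) atTop (𝓝 1)) ∧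
    (k * α ≤ γ → k * α ≠ 1 →
      Tendsto (CoordinationGame.worstCaseEfficiency k α γ) atTop
        (𝓝 (((1 - (k - 1) * α) - α * γ) / ((1 + α) * (1 - k * α))))) ∧
    (∃ ℓ₁ ℓ : ℝ,
      Tendsto (CoordinationGame.worstCaseEfficiency 1 α γ) atTop (𝓝 ℓ₁) ∧
      Tendsto (CoordinationGame.worstCaseEfficiency k α γ) atTop (𝓝 ℓ) ∧
      ℓ₁ ≤ ℓ) := by
  refine ⟨fun h => CoordinationGame.tendsto_worstCaseEfficiency_of_lt hk hα0 hγ0 hγ1 h,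
    fun h hne => ?_,
    CoordinationGame.exists_tendsto_worstCaseEfficiency hk hα0 hα1 hγ0 hγ1⟩
  have hlt : k * α < 1 := lt_of_le_of_ne (h.trans hγ1) hne
  convert CoordinationGame.tendsto_worstCaseEfficiency_of_lt_one hk hα0 hγ0 hγ1 h hlt using 2
  have h1 : 1 + α ≠ 0 := by positivity
  have h2 : 1 - k * α ≠ 0 := by linarith
  field_simp
  ring
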